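/- Let $\mathcal{H},\mathcal{Z}$ be finite-dimensional complex Hilbert spaces, $\mathcal{H}\neq 0$, and let $\mathcal{E},\mathcal{F}$ be quantum operations (completely positive trace-preserving maps) from $L(\mathcal{H})$ to $L(\mathcal{Z})$ with Kraus representations $\mathcal{E}(\rho)=\sum_{i=1}^{r}E_i\rho E_i^\dagger$ and $\mathcal{F}(\rho)=\sum_{j=1}^{s}F_j\rho F_j^\dagger$, where $\sum_i E_i^\dagger E_i=\sum_j F_j^\dagger F_j=I$. An unknown device is $\mathcal{E}$ with prior probability $\Pi_0>0$ and $\mathcal{F}$ with prior probability $\Pi_1>0$, $\Pi_0+\Pi_1=1$. A strategy with $n\ge 1$ uses of the device consists of a density operator on $\mathcal{H}\otimes\mathcal{Y}_1$ and quantum operations $\mathcal{G}_k$ from $L(\mathcal{Z}\otimes\mathcal{Y}_k)$ to $L(\mathcal{H}\otimes\mathcal{Y}_{k+1})$, $1\le k<n$, where $\mathcal{Y}_1,\dots,\mathcal{Y}_n$ are arbitrary finite-dimensional ancillas. The device acts, tensored with the identity of the ancilla, on the initial state and then again after each of $\mathcal{G}_1,\dots,\mathcal{G}_{n-1}$; let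 $\rho_n$ and $\sigma_n$ be the resulting states of $\mathcal{Z}\otimes\mathcal{Y}_n$ when the device is $\mathcal{E}$ and $\mathcal{F}$, respectively. A two-outcome measurement $M_0,M_1\ge 0$, $M_0+M_1=I$, on $\mathcal{Z}\otimes\mathcal{Y}_n$ then has error probability $\Pi_0\operatorname{Tr}(M_1\rho_n)+\Pi_1\operatorname{Tr}(M_0\sigma_n)$. Let $P_{err,min,n}$ be the infimum of the error probabilities over all strategies with $n$ uses and all measurements. **Theorem.** If $I\in\operatorname{span}\{E_i^\dagger F_j : 1\le i\le r,\ 1\le j\le s\}$, then there is a $\mu>0$, depending only on $\mathcal{E},\mathcal{F}$ and the prior (in particular, only on $\mathcal{E},\mathcal{F}$ for the prior $\Pi_0=\Pi_1=\tfrac12$), such that for every $n\ge 1$ every strategy with $n$ uses and every measurement have error probability at least $\mu^n/4$; in particular $P_{err,min,n}\ge\mu^n/4$. -/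

import Mathlib

open scoped ComplexOrder

/-!
A finite-dimensional complex Hilbert space with a chosen orthonormal basis is represented by the
finite index type of that basis. Linear operators are complex matrices, and the tensor product of
two spaces is represented by the product of the index types.
-/

/-- `(Φ ⊗ id) A` for a linear map `Φ` on matrices: `Φ` is applied to the first tensor factor,
i.e. to each of the blocks of `A` that are obtained by fixing the ancilla indices. -/
def ampliate {m n : Type*} (k : Type*)
    (Φ : Matrix m m ℂ →ₗ[ℂ] Matrix n n ℂ) (A : Matrix (m × k) (m × k) ℂ) :
    Matrix (n × k) (n × k) ℂ :=
  Matrix.of fun a b => Φ (Matrix.of fun i j => A (i, a.2) (j, b.2)) a.1 b.1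

/-- A quantum operation: a completely positive and trace-preserving linear map. -/
structure QuantumOperation (m n : Type*) [Fintype m] [Fintype n] where
  map : Matrix m m ℂ →ₗ[ℂ] Matrix n n ℂ
  completelyPositive : ∀ (d : ℕ) (A : Matrix (m × Fin d) (m × Fin d) ℂ),
    A.PosSemidef → (ampliate (Fin d) map A).PosSemidef
  tracePreserving : ∀ A : Matrix m m ℂ, (map A).trace = A.trace

/-- `E₁, …, E_r` are Kraus operators of the quantum operation `𝓔`. -/
def IsKrausRepresentation {m n : Type*} [Fintype m] [DecidableEq m] [Fintype n] {r : ℕ}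
    (E : Fin r → Matrix n m ℂ) (𝓔 : QuantumOperation m n) : Prop :=
  (∀ A : Matrix m m ℂ, 𝓔.map A = ∑ i, E i * A * (E i).conjTranspose) ∧
    ∑ i, (E i).conjTranspose * E i = 1

/-- Density operators. -/
structure DensityOperator (m : Type*) [Fintype m] where
  mat : Matrix m m ℂ
  posSemidef : mat.PosSemidef
  trace_eq_one : mat.trace = 1

/-- Measurements (POVMs) with two outcomes. -/
structure TwoOutcomePOVM (m : Type*) [Fintype m] [DecidableEq m] where
  M₀ : Matrix m m ℂ
  M₁ : Matrix m m ℂ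
  posSemidef₀ : M₀.PosSemidef
  posSemidef₁ : M₁.PosSemidef
  sum_eq_one : M₀ + M₁ = 1

/-- `Strategy H Z n d`: the adaptive strategies that use an unknown device, which takes the system
`H` to the system `Z`, exactly `n` times (`n ≥ 1`), and that end with a `d`-dimensional ancilla.
A state of `H` and an ancilla is prepared and `H` is sent through the device. Before each further
use an arbitrary quantum operation acts on the current output system and ancilla, and yields a new
input system and a new ancilla, of arbitrary finite dimension. -/
inductive Strategy (H Z : Type*) [Fintype H] [Fintype Z] : ℕ → ℕ → Type _
  | prepare {d : ℕ} (ψ : DensityOperator (H × Fin d)) : Strategy H Z 1 d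
  | step {n d d' : ℕ} (S : Strategy H Z n d)
      (G : QuantumOperation (Z × Fin d) (H × Fin d')) : Strategy H Z (n + 1) d'

/-- The state right after the last use of the device, if the device is `𝓔`. -/
def Strategy.output {H Z : Type*} [Fintype H] [Fintype Z] (𝓔 : QuantumOperation H Z) :
    {n d : ℕ} → Strategy H Z n d → Matrix (Z × Fin d) (Z × Fin d) ℂ
  | _, _, .prepare (d := d) ψ => ampliate (Fin d) 𝓔.map ψ.mat
  | _, _, .step (d' := d') S G => ampliate (Fin d') 𝓔.map (G.map (S.output 𝓔))

/-- Probability of a wrong guess when the device is `𝓔` with prior probability `p₀` and `𝓕` with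
prior probability `p₁`, the strategy `S` is carried out, the final state is measured with `M`, and
outcome `0` is read as `𝓔`, outcome `1` as `𝓕`. -/
noncomputable def errorProb {H Z : Type*} [Fintype H] [Fintype Z] [DecidableEq Z]
    (𝓔 𝓕 : QuantumOperation H Z) (p₀ p₁ : ℝ) {n d : ℕ} (S : Strategy H Z n d)
    (M : TwoOutcomePOVM (Z × Fin d)) : ℝ :=
  p₀ * (M.M₁ * S.output 𝓔).trace.re + p₁ * (M.M₀ * S.output 𝓕).trace.re

/-- The optimal error probability over all strategies with `n` uses and all measurements. -/
noncomputable def minErrorProb {H Z : Type*} [Fintype H] [Fintype Z] [DecidableEq Z]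
    (𝓔 𝓕 : QuantumOperation H Z) (p₀ p₁ : ℝ) (n : ℕ) : ℝ :=
  sInf {e : ℝ | ∃ (d : ℕ) (S : Strategy H Z n d) (M : TwoOutcomePOVM (Z × Fin d)),
    e = errorProb 𝓔 𝓕 p₀ p₁ S M}

/-! Two states ρ, σ are kept hard to distinguish by a joint positive block matrix with diagonal
blocks ρ, σ and off-diagonal trace t, a witness that their fidelity is at least |t|. A quantum
operation between uses preserves t (`HasOverlap.map`). If ∑ c i j Eᵢ†Fⱼ = I, one use of the device
merely multiplies t by the fixed factor κ/s (`HasOverlap.kraus`). Since t starts at 1, it equals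
(κ/s)^n after n uses, and Cauchy-Schwarz (`HasOverlap.sq_le`) turns t² into a lower bound on the
error. -/

open Matrix
open scoped Kronecker

/-! ### Overlap witnesses as positive block matrices -/

section TwoByTwoBlocks

variable {m n : Type*}

/-- The `(k, l)` block of a matrix that is indexed by pairs. -/
def pairBlock {κ : Type*} (R : Matrix (m × κ) (m × κ) ℂ) (k l : κ) : Matrix m m ℂ :=
  Matrix.of fun i j => R (i, k) (j, l)

theorem pairBlock_add {κ : Type*} (R S : Matrix (m × κ) (m × κ) ℂ) (k l : κ) :
    pairBlock (R + S) k l = pairBlock R k l + pairBlock S k l := rfl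

theorem pairBlock_smul {κ : Type*} (c : ℂ) (R : Matrix (m × κ) (m × κ) ℂ) (k l : κ) :
    pairBlock (c • R) k l = c • pairBlock R k l := rfl

theorem pairBlock_sum {κ ι : Type*} (s : Finset ι) (R : ι → Matrix (m × κ) (m × κ) ℂ) (k l : κ) :
    pairBlock (∑ i ∈ s, R i) k l = ∑ i ∈ s, pairBlock (R i) k l := by
  ext i j
  simp [pairBlock, Matrix.sum_apply]

theorem pairBlock_conj_blockDiagonal [Fintype m] {κ : Type*} [Fintype κ] [DecidableEq κ]
    (V : κ → Matrix n m ℂ) (R : Matrix (m × κ) (m × κ) ℂ) (k l : κ) :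
    pairBlock (blockDiagonal V * R * (blockDiagonal V)ᴴ) k l =
      V k * pairBlock R k l * (V l)ᴴ := by
  ext i j
  simp [pairBlock, Matrix.mul_apply, Fintype.sum_prod_type, blockDiagonal_apply, ite_mul,
    apply_ite]

/-- Partial traces over the first factor are positive semidefinite. -/
theorem posSemidef_of_trace_pairBlock [Fintype m] {κ : Type*}
    {R : Matrix (m × κ) (m × κ) ℂ} (hR : R.PosSemidef) :
    (Matrix.of fun k l => (pairBlock R k l).trace).PosSemidef := by
  have h : (Matrix.of fun k l => (pairBlock R k l).trace) =
      ∑ a : m, R.submatrix (fun k => (a, k)) (fun k => (a, k)) := by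
    ext k l
    simp [pairBlock, Matrix.trace, Matrix.sum_apply]
  rw [h]
  exact posSemidef_sum _ fun a _ => hR.submatrix _

/-- The operators `ρ` and `σ` are the diagonal blocks of a positive semidefinite block matrix
whose off-diagonal block has trace `t`. -/
def HasOverlap [Fintype m] (ρ σ : Matrix m m ℂ) (t : ℝ) : Prop :=
  ∃ R : Matrix (m × Fin 2) (m × Fin 2) ℂ, R.PosSemidef ∧
    pairBlock R 0 0 = ρ ∧ pairBlock R 1 1 = σ ∧ (pairBlock R 0 1).trace = (t : ℂ)

theorem hasOverlap_self [Fintype m] {ρ : Matrix m m ℂ} (hρ : ρ.PosSemidef) (h1 : ρ.trace = 1) :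
    HasOverlap ρ ρ 1 :=
  ⟨ρ.submatrix Prod.fst Prod.fst, hρ.submatrix _, rfl, rfl, by
    rw [Complex.ofReal_one, ← h1]; rfl⟩

/-- Complete positivity keeps G ⊗ id₂ of the witness positive; trace preservation keeps t. -/
theorem HasOverlap.map [Fintype m] [Fintype n] {ρ σ : Matrix m m ℂ} {t : ℝ}
    (h : HasOverlap ρ σ t) (G : QuantumOperation m n) : HasOverlap (G.map ρ) (G.map σ) t := by
  obtain ⟨R, hR, rfl, rfl, ht⟩ := h
  exact ⟨ampliate (Fin 2) G.map R, G.completelyPositive 2 R hR, rfl, rfl,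
    (G.tracePreserving _).trans ht⟩

theorem HasOverlap.kraus [Fintype m] [DecidableEq m] [Fintype n] {r s : ℕ}
    {E : Fin r → Matrix n m ℂ} {F : Fin s → Matrix n m ℂ} {c : Fin r → Fin s → ℂ}
    (hc : ∑ i, ∑ j, c i j • ((E i)ᴴ * F j) = 1) {κ : ℝ} (hs : 0 < s)
    (hκ : ∀ j, ∑ i, κ ^ 2 * Complex.normSq (c i j) ≤ s)
    {ρ σ : Matrix m m ℂ} {t : ℝ} (h : HasOverlap ρ σ t) :
    HasOverlap (∑ i, E i * ρ * (E i)ᴴ) (∑ j, F j * σ * (F j)ᴴ) (κ / s * t) := by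
  obtain ⟨R, hR, rfl, rfl, ht⟩ := h
  set V : Fin r → Fin s → Fin 2 → Matrix n m ℂ := fun i j => ![E i, ((κ : ℂ) * c i j) • F j]
  -- Conjugating by all V i j yields s𝓔(ρ) in block (0,0), but possibly too little of each FⱼσFⱼ† in
  -- block (1,1). The W j, weighted by w j ≥ 0, supply the deficit without touching the other
  -- blocks.
  set W : Fin s → Fin 2 → Matrix n m ℂ := fun j => ![0, F j]
  set w : Fin s → ℝ := fun j => s - ∑ i, κ ^ 2 * Complex.normSq (c i j) with hw
  have hs' : (s : ℂ) ≠ 0 := by exact_mod_cast hs.ne'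
  refine ⟨(s : ℂ)⁻¹ • ((∑ i, ∑ j, blockDiagonal (V i j) * R * (blockDiagonal (V i j))ᴴ) +
    ∑ j, (w j : ℂ) • (blockDiagonal (W j) * R * (blockDiagonal (W j))ᴴ)), ?_, ?_, ?_, ?_⟩
  · refine PosSemidef.smul (PosSemidef.add ?_ ?_) (by
      rw [← Complex.ofReal_natCast, ← Complex.ofReal_inv]
      exact_mod_cast inv_nonneg.2 (Nat.cast_nonneg s))
    · exact posSemidef_sum _ fun i _ => posSemidef_sum _ fun j _ =>
        hR.mul_mul_conjTranspose_same _
    · refine posSemidef_sum _ fun j _ => (hR.mul_mul_conjTranspose_same _).smul ?_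
      exact_mod_cast sub_nonneg.2 (hκ j)
  · simp only [pairBlock_smul, pairBlock_add, pairBlock_sum, pairBlock_conj_blockDiagonal]
    simp [V, W, ← Finset.smul_sum, ← Nat.cast_smul_eq_nsmul ℂ, smul_smul, hs']
  · simp only [pairBlock_smul, pairBlock_add, pairBlock_sum, pairBlock_conj_blockDiagonal]
    rw [Finset.sum_comm, ← Finset.sum_add_distrib, Finset.smul_sum]
    refine Finset.sum_congr rfl fun j _ => ?_
    simp only [V, W, cons_val_one, cons_val_fin_one, conjTranspose_smul, Matrix.smul_mul,
      Matrix.mul_smul, smul_smul, star_mul', ← Finset.sum_smul, ← add_smul]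
    convert one_smul ℂ (F j * pairBlock R 1 1 * (F j)ᴴ) using 2
    have hz : ∀ i, star (κ : ℂ) * star (c i j) * (κ * c i j) =
        ((κ ^ 2 * Complex.normSq (c i j) : ℝ) : ℂ) := fun i => by
      push_cast
      rw [Complex.normSq_eq_conj_mul_self, Complex.star_def, Complex.conj_ofReal]
      ring
    simp only [hz, hw]
    push_cast
    rw [add_sub_cancel, inv_mul_cancel₀ hs']
  · simp only [pairBlock_smul, pairBlock_add, pairBlock_sum, pairBlock_conj_blockDiagonal]
    have hc' : ∑ i, ∑ j, star (c i j) • ((F j)ᴴ * E i) = 1 := by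
      simpa [conjTranspose_sum] using congrArg conjTranspose hc
    have htr : ∑ i, ∑ j, star (c i j) * (E i * pairBlock R 0 1 * (F j)ᴴ).trace = t := by
      rw [← ht]
      conv_rhs => rw [← Matrix.one_mul (pairBlock R 0 1), ← hc']
      simp only [Finset.sum_mul, trace_sum, Matrix.smul_mul, trace_smul, smul_eq_mul]
      refine Finset.sum_congr rfl fun i _ => Finset.sum_congr rfl fun j _ => ?_
      rw [trace_mul_comm, ← Matrix.mul_assoc]
    simp only [V, W, trace_smul, trace_sum, cons_val_zero, cons_val_one,
      cons_val_fin_one, conjTranspose_smul, Matrix.mul_smul, Matrix.zero_mul, smul_zero,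
      Finset.sum_const_zero, add_zero, smul_eq_mul, star_mul', mul_assoc, ← Finset.mul_sum]
    simp only [← mul_assoc] at htr ⊢
    rw [htr, Complex.star_def, Complex.conj_ofReal]
    push_cast
    ring

/-- The Cauchy-Schwarz inequality for the blocks of a positive semidefinite block matrix. -/
theorem norm_trace_mul_pairBlock_sq_le [Fintype m] [DecidableEq m]
    {R : Matrix (m × Fin 2) (m × Fin 2) ℂ}
    (hR : R.PosSemidef) {M : Matrix m m ℂ} (hM : M.PosSemidef) :
    0 ≤ (M * pairBlock R 0 0).trace.re ∧ 0 ≤ (M * pairBlock R 1 1).trace.re ∧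
    ‖(M * pairBlock R 0 1).trace‖ ^ 2 ≤
      (M * pairBlock R 0 0).trace.re * (M * pairBlock R 1 1).trace.re := by
  -- With M = C†C, the traces of M against the blocks form a positive 2×2 matrix; its determinant
  -- gives the inequality.
  obtain ⟨C, rfl⟩ : ∃ C : Matrix m m ℂ, M = Cᴴ * C := by
    open scoped MatrixOrder in
    exact CStarAlgebra.nonneg_iff_eq_star_mul_self.mp hM.nonneg
  have h := posSemidef_of_trace_pairBlock
    (hR.mul_mul_conjTranspose_same (blockDiagonal fun _ : Fin 2 => C))
  simp only [pairBlock_conj_blockDiagonal] at h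
  have hT : ∀ k l, (C * pairBlock R k l * Cᴴ).trace = (Cᴴ * C * pairBlock R k l).trace :=
    fun k l => by rw [trace_mul_comm, ← Matrix.mul_assoc]
  simp only [hT] at h
  have h0 := h.diag_nonneg (i := 0)
  have h1 := h.diag_nonneg (i := 1)
  have h01 := h.isHermitian.apply 1 0
  have hd := h.det_nonneg
  rw [det_fin_two] at hd
  simp only [of_apply] at h0 h1 h01 hd
  rw [← h01, Complex.star_def, Complex.mul_conj] at hd
  obtain ⟨h0, h0'⟩ := Complex.nonneg_iff.1 h0
  obtain ⟨h1, h1'⟩ := Complex.nonneg_iff.1 h1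
  refine ⟨h0, h1, ?_⟩
  have hre := (Complex.nonneg_iff.1 hd).1
  rw [Complex.sub_re, Complex.mul_re, ← h0', zero_mul, sub_zero, Complex.ofReal_re,
    Complex.normSq_eq_norm_sq] at hre
  exact sub_nonneg.1 hre

/-- Split t over M₀ + M₁ = 1, bound each part by Cauchy-Schwarz with the factor for the correct
guess at most 1, and use (x + y)² ≤ 2(x² + y²). -/
theorem HasOverlap.sq_le [Fintype m] [DecidableEq m] {ρ σ : Matrix m m ℂ} {t : ℝ}
    (h : HasOverlap ρ σ t) (hρ : ρ.trace = 1) (hσ : σ.trace = 1) (M : TwoOutcomePOVM m) :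
    0 ≤ (M.M₁ * ρ).trace.re ∧ 0 ≤ (M.M₀ * σ).trace.re ∧
      t ^ 2 ≤ 2 * ((M.M₁ * ρ).trace.re + (M.M₀ * σ).trace.re) := by
  obtain ⟨R, hR, rfl, rfl, ht⟩ := h
  obtain ⟨a0, b0, c0⟩ := norm_trace_mul_pairBlock_sq_le hR M.posSemidef₀
  obtain ⟨a1, b1, c1⟩ := norm_trace_mul_pairBlock_sq_le hR M.posSemidef₁
  have hsum : ∀ X : Matrix m m ℂ, (M.M₀ * X).trace + (M.M₁ * X).trace = X.trace := fun X => by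
    rw [← trace_add, ← Matrix.add_mul, M.sum_eq_one, Matrix.one_mul]
  have s0 := congrArg Complex.re (hsum (pairBlock R 0 0))
  have s1 := congrArg Complex.re (hsum (pairBlock R 1 1))
  have s01 := hsum (pairBlock R 0 1)
  rw [hρ, Complex.add_re, Complex.one_re] at s0
  rw [hσ, Complex.add_re, Complex.one_re] at s1
  rw [ht] at s01
  have htn : |t| ≤ ‖(M.M₀ * pairBlock R 0 1).trace‖ + ‖(M.M₁ * pairBlock R 0 1).trace‖ := by
    rw [← Real.norm_eq_abs, ← Complex.norm_real, ← s01]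
    exact norm_add_le _ _
  refine ⟨a1, b0, ?_⟩
  set x := ‖(M.M₀ * pairBlock R 0 1).trace‖
  set y := ‖(M.M₁ * pairBlock R 0 1).trace‖
  have hx : x ^ 2 ≤ (M.M₀ * pairBlock R 1 1).trace.re := by nlinarith
  have hy : y ^ 2 ≤ (M.M₁ * pairBlock R 0 0).trace.re := by nlinarith
  have : t ^ 2 ≤ (x + y) ^ 2 := by
    rw [← sq_abs t]
    gcongr
  nlinarith [sq_nonneg (x - y)]

end TwoByTwoBlocks

/-! ### Tensoring with the ancilla -/

section Ampliation

variable {m n k : Type*}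

theorem trace_ampliate [Fintype m] [Fintype n] [Fintype k] (G : QuantumOperation m n)
    (A : Matrix (m × k) (m × k) ℂ) : (ampliate k G.map A).trace = A.trace := by
  have h : ∀ c : k, ∑ a, G.map (Matrix.of fun i j => A (i, c) (j, c)) a a =
      ∑ i, A (i, c) (i, c) := fun c => G.tracePreserving _
  simp only [Matrix.trace, Matrix.diag_apply, ampliate, Matrix.of_apply,
    Fintype.sum_prod_type_right, h]

theorem IsKrausRepresentation.ampliate_eq [Fintype m] [DecidableEq m] [Fintype n]
    [Fintype k] [DecidableEq k] {r : ℕ} {E : Fin r → Matrix n m ℂ} {G : QuantumOperation m n}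
    (hE : IsKrausRepresentation E G) (A : Matrix (m × k) (m × k) ℂ) :
    ampliate k G.map A =
      ∑ i, (E i ⊗ₖ (1 : Matrix k k ℂ)) * A * (E i ⊗ₖ (1 : Matrix k k ℂ))ᴴ := by
  ext a b
  simp [ampliate, hE.1, Matrix.sum_apply, Matrix.mul_apply, Fintype.sum_prod_type,
    Matrix.one_apply, apply_ite, ite_mul]

theorem sum_smul_kronecker_one_eq_one [DecidableEq m] [Fintype n]
    [Fintype k] [DecidableEq k] {r s : ℕ} {E : Fin r → Matrix n m ℂ} {F : Fin s → Matrix n m ℂ}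
    {c : Fin r → Fin s → ℂ} (hc : ∑ i, ∑ j, c i j • ((E i)ᴴ * F j) = 1) :
    ∑ i, ∑ j, c i j • ((E i ⊗ₖ (1 : Matrix k k ℂ))ᴴ * (F j ⊗ₖ (1 : Matrix k k ℂ))) = 1 := by
  have h : ∀ i j, c i j • ((E i ⊗ₖ (1 : Matrix k k ℂ))ᴴ * (F j ⊗ₖ (1 : Matrix k k ℂ))) =
      (kroneckerBilinear (R := ℂ) (l := m) (m := m) (n := k) (p := k) (α := ℂ)).flip 1
        (c i j • ((E i)ᴴ * F j)) := fun i j => by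
    rw [conjTranspose_kronecker, conjTranspose_one, ← mul_kronecker_mul, Matrix.one_mul, map_smul]
    rfl
  simp only [h, ← map_sum, hc]
  exact one_kronecker_one

end Ampliation

/-! ### Induction over the uses of the device -/

section Strategies

variable {H Z : Type*} [Fintype H] [Fintype Z]

theorem Strategy.trace_output (𝓔 : QuantumOperation H Z) {n d : ℕ} (S : Strategy H Z n d) :
    (S.output 𝓔).trace = 1 := by
  induction S with
  | prepare ψ => exact (trace_ampliate 𝓔 _).trans ψ.trace_eq_one
  | step S G ih => exact (trace_ampliate 𝓔 _).trans ((G.tracePreserving _).trans ih)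

theorem Strategy.hasOverlap_output [DecidableEq H] {𝓔 𝓕 : QuantumOperation H Z} {r s : ℕ}
    {E : Fin r → Matrix Z H ℂ} {F : Fin s → Matrix Z H ℂ}
    (hE : IsKrausRepresentation E 𝓔) (hF : IsKrausRepresentation F 𝓕) {c : Fin r → Fin s → ℂ}
    (hc : ∑ i, ∑ j, c i j • ((E i)ᴴ * F j) = 1) {κ : ℝ} (hs : 0 < s)
    (hκ : ∀ j, ∑ i, κ ^ 2 * Complex.normSq (c i j) ≤ s) {n d : ℕ} (S : Strategy H Z n d) :
    HasOverlap (S.output 𝓔) (S.output 𝓕) ((κ / s) ^ n) := by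
  have key : ∀ {d : ℕ} {ρ σ : Matrix (H × Fin d) (H × Fin d) ℂ} {t : ℝ}, HasOverlap ρ σ t →
      HasOverlap (ampliate (Fin d) 𝓔.map ρ) (ampliate (Fin d) 𝓕.map σ) (κ / s * t) := by
    intro d ρ σ t h
    rw [hE.ampliate_eq, hF.ampliate_eq]
    exact h.kraus (sum_smul_kronecker_one_eq_one hc) hs hκ
  induction S with
  | prepare ψ =>
    rw [pow_one, ← mul_one (κ / s)]
    exact key (hasOverlap_self ψ.posSemidef ψ.trace_eq_one)
  | step S G ih =>
    rw [pow_succ']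
    exact key (ih.map G)

/-- The operation that discards its input and prepares the state `ψ`. -/
def QuantumOperation.discardAndPrepare {m n : Type*} [Fintype m] [Fintype n]
    (ψ : DensityOperator n) : QuantumOperation m n where
  map := (Matrix.traceLinearMap m ℂ ℂ).smulRight ψ.mat
  completelyPositive d A hA := by
    have h : ampliate (Fin d) ((Matrix.traceLinearMap m ℂ ℂ).smulRight ψ.mat) A =
        ψ.mat ⊗ₖ (Matrix.of fun k l => (pairBlock A k l).trace) := by
      ext a b
      exact mul_comm (pairBlock A a.2 b.2).trace (ψ.mat a.1 b.1)
    rw [h]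
    exact ψ.posSemidef.kronecker (posSemidef_of_trace_pairBlock hA)
  tracePreserving A := by simp [ψ.trace_eq_one]

theorem nonempty_densityOperator (m : Type*) [Fintype m] [Nonempty m] :
    Nonempty (DensityOperator m) := by
  classical
  obtain ⟨a⟩ := ‹Nonempty m›
  exact ⟨⟨vecMulVec (Pi.single a 1) (star (Pi.single a 1)), posSemidef_vecMulVec_self_star _,
    by simp [trace_vecMulVec]⟩⟩

theorem nonempty_strategy [Nonempty H] {n : ℕ} (hn : 1 ≤ n) : Nonempty (Strategy H Z n 1) := by
  obtain ⟨ψ⟩ := nonempty_densityOperator (H × Fin 1)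
  induction n, hn using Nat.le_induction with
  | base => exact ⟨.prepare ψ⟩
  | succ n _ ih => exact ih.map fun S => S.step (.discardAndPrepare ψ)

theorem nonempty_twoOutcomePOVM (m : Type*) [Fintype m] [DecidableEq m] :
    Nonempty (TwoOutcomePOVM m) :=
  ⟨⟨0, 1, .zero, .one, zero_add 1⟩⟩

end Strategies

theorem mainTheorem3 {H Z : Type*} [Fintype H] [DecidableEq H] [Nonempty H]
    [Fintype Z] [DecidableEq Z]
    (𝓔 𝓕 : QuantumOperation H Z) {r s : ℕ}
    (E : Fin r → Matrix Z H ℂ) (F : Fin s → Matrix Z H ℂ)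
    (hE : IsKrausRepresentation E 𝓔) (hF : IsKrausRepresentation F 𝓕)
    (hspan : (1 : Matrix H H ℂ) ∈
      Submodule.span ℂ (Set.range fun ij : Fin r × Fin s => (E ij.1).conjTranspose * F ij.2))
    (p₀ p₁ : ℝ) (hp₀ : 0 < p₀) (hp₁ : 0 < p₁) (hp : p₀ + p₁ = 1) :
    ∃ μ : ℝ, 0 < μ ∧ ∀ n : ℕ, 1 ≤ n →
      (∀ (d : ℕ) (S : Strategy H Z n d) (M : TwoOutcomePOVM (Z × Fin d)),
        μ ^ n / 4 ≤ errorProb 𝓔 𝓕 p₀ p₁ S M) ∧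
      μ ^ n / 4 ≤ minErrorProb 𝓔 𝓕 p₀ p₁ n := by
  obtain ⟨c', hc'⟩ := (Submodule.mem_span_range_iff_exists_fun ℂ).1 hspan
  set c : Fin r → Fin s → ℂ := fun i j => c' (i, j)
  have hc : ∑ i, ∑ j, c i j • ((E i)ᴴ * F j) = 1 := by
    rw [← hc', Fintype.sum_prod_type]
  -- An empty sum cannot be the identity, as H is nonzero.
  have hs : 0 < s := by
    rcases Nat.eq_zero_or_pos s with rfl | h
    · simp at hc
    · exact h
  set T : ℝ := ∑ j, ∑ i, Complex.normSq (c i j)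
  have hT : 0 ≤ T := Finset.sum_nonneg fun j _ => Finset.sum_nonneg fun i _ =>
    Complex.normSq_nonneg _
  -- Any κ > 0 with κ²T ≤ 1 ≤ s would do.
  set κ : ℝ := (1 + T)⁻¹ with hκdef
  have hκ0 : 0 < κ := by positivity
  have hκ1 : κ ^ 2 * T ≤ 1 := by
    have : κ * (1 + T) = 1 := inv_mul_cancel₀ (by positivity)
    nlinarith [mul_nonneg hκ0.le hT]
  have hκ : ∀ j, ∑ i, κ ^ 2 * Complex.normSq (c i j) ≤ s := fun j => by
    rw [← Finset.mul_sum]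
    have h1 : ∑ i, Complex.normSq (c i j) ≤ T :=
      Finset.single_le_sum (f := fun j => ∑ i, Complex.normSq (c i j))
        (fun j _ => Finset.sum_nonneg fun i _ => Complex.normSq_nonneg _) (Finset.mem_univ j)
    have h2 : (1 : ℝ) ≤ s := by exact_mod_cast hs
    nlinarith [mul_le_mul_of_nonneg_left h1 (sq_nonneg κ)]
  set p : ℝ := min p₀ p₁
  have hp_pos : 0 < p := lt_min hp₀ hp₁
  have hs' : (0 : ℝ) < s := by exact_mod_cast hs
  refine ⟨p * (κ / s) ^ 2, by positivity, fun n hn => ?_⟩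
  have main : ∀ (d : ℕ) (S : Strategy H Z n d) (M : TwoOutcomePOVM (Z × Fin d)),
      (p * (κ / s) ^ 2) ^ n / 4 ≤ errorProb 𝓔 𝓕 p₀ p₁ S M := fun d S M => by
    obtain ⟨ha, hb, hab⟩ := (S.hasOverlap_output hE hF hc hs hκ).sq_le
      (S.trace_output 𝓔) (S.trace_output 𝓕) M
    -- Since p ≤ 1 and n ≥ 1, the single prior factor p can be absorbed into μ^n.
    have h1 : p ^ n ≤ p := pow_le_of_le_one hp_pos.le
      ((min_le_left _ _).trans (by linarith)) (by omega)
    rw [mul_pow, pow_right_comm]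
    unfold errorProb
    have h2 := mul_le_mul_of_nonneg_right (min_le_left p₀ p₁) ha
    have h3 := mul_le_mul_of_nonneg_right (min_le_right p₀ p₁) hb
    have h4 := mul_le_mul_of_nonneg_right h1 (sq_nonneg ((κ / s) ^ n))
    have h5 := mul_le_mul_of_nonneg_left hab hp_pos.le
    have h6 := mul_nonneg hp_pos.le (add_nonneg ha hb)
    linarith
  refine ⟨main, le_csInf ?_ ?_⟩
  -- The infimum needs a nonempty set: `sInf ∅ = 0` would break the bound.
  · obtain ⟨S⟩ := nonempty_strategy (H := H) (Z := Z) hn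
    obtain ⟨M⟩ := nonempty_twoOutcomePOVM (Z × Fin 1)
    exact ⟨_, 1, S, M, rfl⟩
  · rintro _ ⟨d, S, M, rfl⟩
    exact main d S M
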